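/- Let $A=\{a,a^{-1}\}$, let $F$ be the free inverse monoid on one generator $a$ and let $\theta:A^*\to F$ be the canonical homomorphism. Every $u\in F$ has a unique factorization $u=a^{-m}a^{m+k}a^{-k}a^{p}$ with $m,k\in\mathbb N=\{0,1,2,\dots\}$, $p\in\mathbb Z$ and $-m\le p\le k$ (negative powers being powers of the inverse of $a$); put $u\lambda=-m$, $u\rho=k$, $u\pi=p$. Equivalently, the Munn tree of $u$ is the segment $[u\lambda,u\rho]$ of the integer line, with initial vertex $0$ and terminal vertex $u\pi$. For an integer $n\ge 1$ let $$G_{n,1}=\{u\in F: u\pi\ge 0,\ u\lambda\le -n\},\quad G_{n,2}=\{u\in F: u\pi\ge n\},\quad G_{n,3}=\{u\in F: u\pi\ge 0,\ u\rho-u\pi\ge n\},$$ and for $u\in G_{n,i}$ let $u'=u\xi_{n,i}\in F$ be the element determined by - $u'\lambda=u\lambda+n,\ u'\rho=u\rho,\ u'\pi=u\pi$ if $i=1$; - $u'\lambda=u\lambda,\ u'\rho=u\rho-n,\ u'\pi=u\pi-n$ if $i=2$; - $u'\lambda=u\lambda,\ u'\rho=u\rho-n,\ u'\pi=u\pi$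 if $i=3$. The rational subsets of $F$ are the subsets obtained from finite subsets by finitely many applications of union, product and star ($X^*=\bigcup_{n\ge 0}X^n$). **Cut and paste lemma.** For every rational subset $L$ of $F$ there exist computable integers $n'\ge n\ge 1$ such that, for every $i\in\{1,2,3\}$ and every $u\in G_{n',i}$, $$u\in L\iff u\xi_{n,i}\in L .$$ Here "computable" means the following. Every rational subset $L$ of $F$ equals $(L(\mathcal A))\theta$ for some finite automaton $\mathcal A$ over $A$ (with finite vertex set and given sets of initial vertices, terminal vertices and labelled edges), where $L(\mathcal A)$ is the language of $\mathcal A$; and there is an algorithm that computes, from any finite automaton $\mathcal A$ presenting a rational subset $L=(L(\mathcal A))\theta$ of $F$, integers $n$ and $n'$ with the above properties for $L$. -/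

import Mathlib

open scoped Pointwise

/-- The letters of the doubled alphabet: `(x, true)` is the letter `x` and `(x, false)` is the
formal inverse letter `x⁻¹`. -/
abbrev InvLetter (X : Type*) : Type _ := X × Bool

/-- The involution `w ↦ w⁻¹` on words over the doubled alphabet (reverse the word and invert every
letter). -/
def invWord {X : Type*} (w : FreeMonoid (InvLetter X)) : FreeMonoid (InvLetter X) :=
  FreeMonoid.ofList ((w.toList.map fun x => (x.1, !x.2)).reverse)

/-- The defining relations of the free inverse monoid. -/
inductive WagnerRel (X : Type*) :
    FreeMonoid (InvLetter X) → FreeMonoid (InvLetter X) → Prop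
  | regular (w : FreeMonoid (InvLetter X)) : WagnerRel X (w * invWord w * w) w
  | idem_comm (u v : FreeMonoid (InvLetter X)) :
      WagnerRel X (u * invWord u * (v * invWord v)) (v * invWord v * (u * invWord u))

/-- The Wagner congruence: the congruence generated by the defining relations. -/
def wagnerCon (X : Type*) : Con (FreeMonoid (InvLetter X)) := conGen (WagnerRel X)

/-- The free inverse monoid on `X`. -/
abbrev FreeInverseMonoid (X : Type*) : Type _ := (wagnerCon X).Quotient

/-- The monogenic free inverse monoid `F`, the free inverse monoid on one generator `a`. -/
abbrev MonoFIM : Type := FreeInverseMonoid Unit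

namespace MonoFIM

/-- The alphabet `A = {a, a⁻¹}`. -/
abbrev Letter : Type := InvLetter Unit

/-- The canonical surjective homomorphism `θ : A* → F`. -/
def theta : FreeMonoid Letter →* MonoFIM := (wagnerCon Unit).mk'

/-- The generator `a`. -/
def gen : MonoFIM := theta (FreeMonoid.of ((), true))

/-- The inverse `a⁻¹` of the generator. -/
def genInv : MonoFIM := theta (FreeMonoid.of ((), false))

/-- The power `a ^ z` for an integer `z`, with `a ^ (-k) = (a⁻¹) ^ k`. -/
def genPow (z : ℤ) : MonoFIM := if 0 ≤ z then gen ^ z.toNat else genInv ^ (-z).toNat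

end MonoFIM

/-- The Munn trees over one generator: a finite segment `[left, right]` of the integer line
(consecutive integers being joined by an edge labelled `a`) with initial vertex `0` and
terminal vertex `pt`. -/
@[ext] structure MunnSegment where
  left : ℤ
  pt : ℤ
  right : ℤ
  left_le_zero : left ≤ 0
  zero_le_right : 0 ≤ right
  left_le_pt : left ≤ pt
  pt_le_right : pt ≤ right

namespace MunnSegment

/-- The one-vertex segment. -/
instance : One MunnSegment := ⟨⟨0, 0, 0, le_rfl, le_rfl, le_rfl, le_rfl⟩⟩

/-- The product glues the initial vertex of the second segment to the terminal vertex of the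
first. -/
instance : Mul MunnSegment where
  mul x y :=
    { left := min x.left (x.pt + y.left)
      pt := x.pt + y.pt
      right := max x.right (x.pt + y.right)
      left_le_zero := (min_le_left _ _).trans x.left_le_zero
      zero_le_right := x.zero_le_right.trans (le_max_left _ _)
      left_le_pt := by have := y.left_le_pt; omega
      pt_le_right := by have := y.pt_le_right; omega }

theorem one_left : (1 : MunnSegment).left = 0 := rfl
theorem one_pt : (1 : MunnSegment).pt = 0 := rfl
theorem one_right : (1 : MunnSegment).right = 0 := rfl
theorem mul_left (x y : MunnSegment) : (x * y).left = min x.left (x.pt + y.left) := rfl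
theorem mul_pt (x y : MunnSegment) : (x * y).pt = x.pt + y.pt := rfl
theorem mul_right (x y : MunnSegment) : (x * y).right = max x.right (x.pt + y.right) := rfl

instance : Monoid MunnSegment where
  one_mul x := by
    have := x.left_le_zero; have := x.zero_le_right
    ext <;> simp only [mul_left, mul_pt, mul_right, one_left, one_pt, one_right] <;> omega
  mul_one x := by
    have := x.left_le_pt; have := x.pt_le_right
    ext <;> simp only [mul_left, mul_pt, mul_right, one_left, one_pt, one_right] <;> omega
  mul_assoc x y z := by
    ext <;> simp only [mul_left, mul_pt, mul_right] <;> omega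

/-- The Munn tree with initial and terminal vertices exchanged (translated so that the new initial
vertex is `0`). -/
def rev (x : MunnSegment) : MunnSegment where
  left := x.left - x.pt
  pt := -x.pt
  right := x.right - x.pt
  left_le_zero := by have := x.left_le_pt; omega
  zero_le_right := by have := x.pt_le_right; omega
  left_le_pt := by have := x.left_le_zero; omega
  pt_le_right := by have := x.zero_le_right; omega

/-- The Munn tree of a single letter. -/
def ofLetter (x : MonoFIM.Letter) : MunnSegment :=
  if x.2 then ⟨0, 1, 1, by omega, by omega, by omega, by omega⟩
  else ⟨-1, -1, 0, by omega, by omega, by omega, by omega⟩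

/-- The Munn tree of a word over `{a, a⁻¹}`. -/
def ofWord : FreeMonoid MonoFIM.Letter →* MunnSegment := FreeMonoid.lift ofLetter

theorem rev_mul (x y : MunnSegment) : (x * y).rev = y.rev * x.rev := by
  ext <;> simp only [rev, mul_left, mul_pt, mul_right] <;> omega

theorem ofWord_invWord (w : FreeMonoid MonoFIM.Letter) : ofWord (invWord w) = (ofWord w).rev := by
  induction w using FreeMonoid.inductionOn' with
  | one => ext <;> simp [invWord, rev, one_left, one_pt, one_right]
  | of_mul x w ih =>
    have h1 : invWord (FreeMonoid.of x * w) = invWord w * FreeMonoid.of (x.1, !x.2) := by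
      simp [invWord, FreeMonoid.toList_mul, FreeMonoid.ofList_append]
    rw [h1, map_mul, map_mul, rev_mul, ih]
    congr 1
    rcases x with ⟨_, _ | _⟩ <;> ext <;> simp [ofWord, rev, ofLetter]

theorem wagnerCon_le_ker : wagnerCon Unit ≤ Con.ker ofWord := by
  refine Con.conGen_le.2 ?_
  rintro _ w (_ | ⟨u, v⟩)
  · have h1 := (ofWord w).left_le_zero
    have h2 := (ofWord w).zero_le_right
    have h3 := (ofWord w).left_le_pt
    have h4 := (ofWord w).pt_le_right
    rw [Con.ker_rel, map_mul, map_mul, ofWord_invWord]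
    ext <;> simp only [rev, mul_left, mul_pt, mul_right] <;> omega
  · rw [Con.ker_rel, map_mul, map_mul, map_mul, map_mul, map_mul, map_mul, ofWord_invWord,
      ofWord_invWord]
    ext <;> simp only [rev, mul_left, mul_pt, mul_right] <;> omega

end MunnSegment

namespace MonoFIM

/-- The Munn tree of an element of `F`. -/
def munnTree : MonoFIM →* MunnSegment := Con.lift _ _ MunnSegment.wagnerCon_le_ker

/-- `u ↦ uλ`: the (nonpositive) position of the left end of the Munn tree. -/
def lam (u : MonoFIM) : ℤ := (munnTree u).left

/-- `u ↦ uρ`: the (nonnegative) position of the right end of the Munn tree. -/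
def rho (u : MonoFIM) : ℤ := (munnTree u).right

/-- `u ↦ uπ`: the position of the terminal vertex of the Munn tree. -/
def proj (u : MonoFIM) : ℤ := (munnTree u).pt

theorem munnTree_gen_pow (k : ℕ) :
    munnTree (gen ^ k) = ⟨0, k, k, by omega, by omega, by omega, by omega⟩ := by
  induction k with
  | zero => rw [pow_zero, map_one]; rfl
  | succ k ih =>
    have h : munnTree gen = ⟨0, 1, 1, by omega, by omega, by omega, by omega⟩ := rfl
    rw [pow_succ, map_mul, ih, h]
    ext <;> simp only [MunnSegment.mul_left, MunnSegment.mul_pt, MunnSegment.mul_right] <;>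
      omega

theorem munnTree_genInv_pow (k : ℕ) :
    munnTree (genInv ^ k) = ⟨-k, -k, 0, by omega, by omega, by omega, by omega⟩ := by
  induction k with
  | zero => rw [pow_zero, map_one]; rfl
  | succ k ih =>
    have h : munnTree genInv = ⟨-1, -1, 0, by omega, by omega, by omega, by omega⟩ := rfl
    rw [pow_succ, map_mul, ih, h]
    ext <;> simp only [MunnSegment.mul_left, MunnSegment.mul_pt, MunnSegment.mul_right] <;>
      omega

theorem munnTree_genPow (z : ℤ) : munnTree (genPow z) =
    ⟨min z 0, z, max z 0, by omega, by omega, by omega, by omega⟩ := by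
  unfold genPow
  split_ifs with h
  · rw [munnTree_gen_pow]; ext <;> simp only <;> omega
  · rw [munnTree_genInv_pow]; ext <;> simp only <;> omega

/-- The element `a^l a^(r - l) a^(-r) a^p` of `F`. For `l ≤ 0 ≤ r` and `l ≤ p ≤ r` it is the
element with `λ = l`, `π = p` and `ρ = r`. -/
def ofSegment (l p r : ℤ) : MonoFIM :=
  genPow l * genPow (r - l) * genPow (-r) * genPow p

theorem munnTree_ofSegment (x : MunnSegment) :
    munnTree (ofSegment x.left x.pt x.right) = x := by
  have := x.left_le_zero; have := x.zero_le_right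
  have := x.left_le_pt; have := x.pt_le_right
  simp only [ofSegment, map_mul, munnTree_genPow]
  ext <;> simp only [MunnSegment.mul_left, MunnSegment.mul_pt, MunnSegment.mul_right] <;>
    omega

theorem theta_surjective : Function.Surjective theta := Con.mk'_surjective

theorem theta_eq_of_rel {v w : FreeMonoid Letter} (h : WagnerRel Unit v w) :
    theta v = theta w := (Con.eq _).2 (ConGen.Rel.of _ _ h)

theorem invWord_pow (x : Letter) (k : ℕ) :
    invWord (FreeMonoid.of x ^ k) = FreeMonoid.of (x.1, !x.2) ^ k := by
  have h : ∀ (z : Letter) (j : ℕ), FreeMonoid.toList (FreeMonoid.of z ^ j) = List.replicate j z := by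
    intro z j
    induction j with
    | zero => rfl
    | succ j ih => rw [pow_succ', FreeMonoid.toList_mul, ih]; rfl
  apply FreeMonoid.toList.injective
  rw [h]
  simp [invWord, h]

theorem theta_pow (b : Bool) (k : ℕ) :
    theta (FreeMonoid.of ((), b) ^ k) = if b then gen ^ k else genInv ^ k := by
  cases b <;> simp [gen, genInv]

theorem gen_mul_genInv_mul_gen : gen * genInv * gen = gen :=
  theta_eq_of_rel (WagnerRel.regular (FreeMonoid.of ((), true)))

theorem genInv_mul_gen_mul_genInv : genInv * gen * genInv = genInv :=
  theta_eq_of_rel (WagnerRel.regular (FreeMonoid.of ((), false)))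

theorem idem_comm (k m : ℕ) : gen ^ k * genInv ^ k * (genInv ^ m * gen ^ m) =
    genInv ^ m * gen ^ m * (gen ^ k * genInv ^ k) := by
  have h := theta_eq_of_rel (WagnerRel.idem_comm (FreeMonoid.of ((), true) ^ k)
    (FreeMonoid.of ((), false) ^ m))
  simpa [invWord_pow, theta_pow] using h

theorem pow_mul_pow_mul (x y : MonoFIM) (hx : x * y * x = x)
    (hc : ∀ k m, x ^ k * y ^ k * (y ^ m * x ^ m) = y ^ m * x ^ m * (x ^ k * y ^ k)) (q : ℕ) :
    x ^ (q + 1) * y ^ (q + 1) * x = x ^ (q + 1) * y ^ q := by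
  have h := hc q 1
  simp only [pow_one] at h
  calc x ^ (q + 1) * y ^ (q + 1) * x = x * (x ^ q * y ^ q * (y * x)) := by
        rw [pow_succ', pow_succ]; simp only [mul_assoc]
    _ = x * y * x * (x ^ q * y ^ q) := by rw [h]; simp only [mul_assoc]
    _ = _ := by rw [hx, pow_succ']; simp only [mul_assoc]

theorem pow_regular (x y : MonoFIM) (hx : x * y * x = x)
    (hc : ∀ k m, x ^ k * y ^ k * (y ^ m * x ^ m) = y ^ m * x ^ m * (x ^ k * y ^ k)) (q : ℕ) :
    x ^ q * y ^ q * x ^ q = x ^ q := by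
  induction q with
  | zero => simp
  | succ q ih =>
    rw [pow_succ' x q, ← mul_assoc (x * x ^ q * y ^ (q + 1)), ← pow_succ',
      pow_mul_pow_mul x y hx hc, pow_succ', mul_assoc x, mul_assoc x, ih]

theorem pow_mul_pow_mul_of_le (x y : MonoFIM) (hy : y * x * y = y)
    (hc : ∀ k m, y ^ k * x ^ k * (x ^ m * y ^ m) = x ^ m * y ^ m * (y ^ k * x ^ k)) {q k : ℕ}
    (hq : q + 1 ≤ k) : x ^ k * y ^ k * x ^ (q + 1) * y = x ^ k * y ^ k * x ^ q := by
  obtain ⟨j, rfl⟩ := Nat.exists_eq_add_of_le' hq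
  have h := pow_mul_pow_mul y x hy hc q
  rw [pow_add y, mul_assoc _ _ (x ^ (q + 1)), mul_assoc _ _ y, mul_assoc _ _ (x ^ (q + 1)),
    mul_assoc _ _ y, h]
  simp only [mul_assoc]

theorem ofSegment_eq (m k : ℕ) (p : ℤ) : ofSegment (-m) p k =
    genInv ^ m * gen ^ m * (gen ^ k * genInv ^ k) * genPow p := by
  have h : ∀ j : ℕ, genPow (-(j : ℤ)) = genInv ^ j := by
    intro j; rcases j with _ | j
    · simp [genPow]
    · rw [genPow, if_neg (by omega)]; congr 1
  have h' : genPow ((k : ℤ) - -(m : ℤ)) = gen ^ (m + k) := by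
    rw [genPow, if_pos (by omega)]; congr 1; omega
  rw [ofSegment, h, h, h', pow_add]
  simp only [mul_assoc]

theorem ofSegment_mul_gen (m k : ℕ) (p : ℤ) (h1 : -m ≤ p) (h2 : p ≤ k) :
    ofSegment (-m) p k * gen = ofSegment (-m) (p + 1) (max k (p + 1)) := by
  rcases lt_or_ge p 0 with h | h
  · obtain ⟨q, rfl⟩ : ∃ q : ℕ, p = -((q : ℤ) + 1) := ⟨(-p - 1).toNat, by omega⟩
    have e1 : genPow (-((q : ℤ) + 1)) = genInv ^ (q + 1) := by
      rw [genPow, if_neg (by omega)]; congr 1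
    have e2 : genPow (-((q : ℤ) + 1) + 1) = genInv ^ q := by
      rcases q with _ | q
      · simp [genPow]
      · rw [genPow, if_neg (by omega)]; congr 1
    have key := pow_mul_pow_mul_of_le genInv gen gen_mul_genInv_mul_gen idem_comm
      (q := q) (k := m) (by omega)
    rw [max_eq_left (by omega), ofSegment_eq, ofSegment_eq, e1, e2, ← idem_comm,
      mul_assoc _ _ (genInv ^ (q + 1)), mul_assoc _ _ gen, key]
    simp only [mul_assoc]
  · obtain ⟨q, rfl⟩ := Int.eq_ofNat_of_zero_le h
    have e : ∀ j : ℕ, genPow (j : ℤ) = gen ^ j := fun j => by simp [genPow]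
    have e2 : genPow ((q : ℤ) + 1) = gen ^ (q + 1) := by exact_mod_cast e (q + 1)
    have reg := pow_regular gen genInv gen_mul_genInv_mul_gen idem_comm
    rcases eq_or_lt_of_le h2 with h3 | h3
    · obtain rfl : q = k := by exact_mod_cast h3
      have e3 : max (q : ℤ) (q + 1) = ((q + 1 : ℕ) : ℤ) := by push_cast; omega
      rw [e3, ofSegment_eq, ofSegment_eq, e, e2, mul_assoc _ _ (gen ^ q), reg,
        mul_assoc _ _ (gen ^ (q + 1)), reg, mul_assoc, pow_succ gen q]
    · rw [max_eq_left (by omega), ofSegment_eq, ofSegment_eq, e, e2, pow_succ, mul_assoc]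

theorem ofSegment_mul_genInv (m k : ℕ) (p : ℤ) (h1 : -m ≤ p) (h2 : p ≤ k) :
    ofSegment (-m) p k * genInv = ofSegment (min (-m) (p - 1)) (p - 1) k := by
  rcases lt_or_ge 0 p with h | h
  · obtain ⟨q, rfl⟩ : ∃ q : ℕ, p = (q : ℤ) + 1 := ⟨(p - 1).toNat, by omega⟩
    have e1 : genPow ((q : ℤ) + 1) = gen ^ (q + 1) := by
      rw [genPow, if_pos (by omega)]; congr 1
    have e2 : genPow ((q : ℤ) + 1 - 1) = gen ^ q := by simp [genPow]
    have key := pow_mul_pow_mul_of_le gen genInv genInv_mul_gen_mul_genInv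
      (fun a b => (idem_comm b a).symm) (q := q) (k := k) (by omega)
    rw [min_eq_left (by omega), ofSegment_eq, ofSegment_eq, e1, e2,
      mul_assoc _ _ (gen ^ (q + 1)), mul_assoc _ _ genInv, key]
    simp only [mul_assoc]
  · obtain ⟨q, rfl⟩ : ∃ q : ℕ, p = -(q : ℤ) := ⟨(-p).toNat, by omega⟩
    have e : ∀ j : ℕ, genPow (-(j : ℤ)) = genInv ^ j := by
      intro j; rcases j with _ | j
      · simp [genPow]
      · rw [genPow, if_neg (by omega)]; congr 1
    have e2 : genPow (-(q : ℤ) - 1) = genInv ^ (q + 1) := by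
      rw [← e (q + 1)]; congr 1; push_cast; omega
    have reg := pow_regular genInv gen genInv_mul_gen_mul_genInv
      (fun a b => (idem_comm b a).symm)
    rcases eq_or_lt_of_le h1 with h3 | h3
    · obtain rfl : m = q := by omega
      have e3 : min (-(m : ℤ)) (-(m : ℤ) - 1) = -((m + 1 : ℕ) : ℤ) := by push_cast; omega
      rw [e3, ofSegment_eq, ofSegment_eq, e, e2, ← idem_comm, ← idem_comm,
        mul_assoc _ _ (genInv ^ m), reg, mul_assoc _ _ (genInv ^ (m + 1)), reg, mul_assoc,
        pow_succ genInv m]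
    · rw [min_eq_left (by omega), ofSegment_eq, ofSegment_eq, e, e2, pow_succ, mul_assoc]

/-- The canonical factorization `u = a^(uλ) a^(uρ - uλ) a^(-uρ) a^(uπ)`. -/
theorem ofSegment_lam_proj_rho (u : MonoFIM) : ofSegment (lam u) (proj u) (rho u) = u := by
  obtain ⟨w, rfl⟩ := theta_surjective u
  have main : ∀ l : List Letter, ofSegment (lam (theta (FreeMonoid.ofList l)))
      (proj (theta (FreeMonoid.ofList l))) (rho (theta (FreeMonoid.ofList l))) =
      theta (FreeMonoid.ofList l) := by
    intro l
    induction l using List.reverseRecOn with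
    | nil =>
      change ofSegment 0 0 0 = 1
      simp [ofSegment, genPow]
    | append_singleton l x ih =>
      rw [FreeMonoid.ofList_append, map_mul]
      generalize theta (FreeMonoid.ofList l) = v at ih
      have i1 : lam v ≤ 0 := (munnTree v).left_le_zero
      have i2 : 0 ≤ rho v := (munnTree v).zero_le_right
      have i3 : lam v ≤ proj v := (munnTree v).left_le_pt
      have i4 : proj v ≤ rho v := (munnTree v).pt_le_right
      obtain ⟨m, hm⟩ : ∃ m : ℕ, lam v = -m := ⟨(-lam v).toNat, by omega⟩
      obtain ⟨k, hk⟩ : ∃ k : ℕ, rho v = k := ⟨(rho v).toNat, by omega⟩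
      rcases x with ⟨_, _ | _⟩
      · have s := ofSegment_mul_genInv m k (proj v) (by omega) (by omega)
        rw [← hm, ← hk, ih] at s
        change ofSegment (lam (v * genInv)) (proj (v * genInv)) (rho (v * genInv)) = v * genInv
        have t : munnTree (v * genInv) = munnTree v * munnTree genInv := map_mul _ _ _
        rw [lam, proj, rho, t]
        change ofSegment (min (lam v) (proj v + -1)) (proj v + -1) (max (rho v) (proj v + 0)) =
          v * genInv
        rw [s, max_eq_left (by omega)]; rfl
      · have s := ofSegment_mul_gen m k (proj v) (by omega) (by omega)
        rw [← hm, ← hk, ih] at s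
        change ofSegment (lam (v * gen)) (proj (v * gen)) (rho (v * gen)) = v * gen
        have t : munnTree (v * gen) = munnTree v * munnTree gen := map_mul _ _ _
        rw [lam, proj, rho, t]
        change ofSegment (min (lam v) (proj v + 0)) (proj v + 1) (max (rho v) (proj v + 1)) =
          v * gen
        rw [s, min_eq_left (by omega)]
  exact main w.toList

/-- An element of `F` is determined by its Munn tree. -/
theorem munnTree_injective : Function.Injective munnTree := by
  intro u v h
  rw [← ofSegment_lam_proj_rho u, ← ofSegment_lam_proj_rho v, lam, lam, proj, proj, rho, rho, h]

/-- The sets `G_{n,1}`, `G_{n,2}`, `G_{n,3}`, indexed here by `0`, `1`, `2`. -/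
def G (n : ℕ) : Fin 3 → Set MonoFIM
  | 0 => {u | 0 ≤ proj u ∧ lam u ≤ -(n : ℤ)}
  | 1 => {u | (n : ℤ) ≤ proj u}
  | 2 => {u | 0 ≤ proj u ∧ (n : ℤ) ≤ rho u - proj u}

/-- The maps `ξ_{n,1}`, `ξ_{n,2}`, `ξ_{n,3}`, indexed here by `0`, `1`, `2`; only the values on
`G n i` are meaningful. -/
def xi (n : ℕ) : Fin 3 → MonoFIM → MonoFIM
  | 0, u => ofSegment (lam u + n) (proj u) (rho u)
  | 1, u => ofSegment (lam u) (proj u - n) (rho u - n)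
  | 2, u => ofSegment (lam u) (proj u) (rho u - n)

theorem xi_zero_spec {n : ℕ} {u : MonoFIM} (hu : u ∈ G n 0) :
    lam (xi n 0 u) = lam u + n ∧ rho (xi n 0 u) = rho u ∧ proj (xi n 0 u) = proj u := by
  obtain ⟨h1, h2⟩ := hu
  have h := munnTree_ofSegment ⟨lam u + n, proj u, rho u, by omega,
    (munnTree u).zero_le_right, by omega, (munnTree u).pt_le_right⟩
  exact ⟨congrArg (·.left) h, congrArg (·.right) h, congrArg (·.pt) h⟩

theorem xi_one_spec {n : ℕ} {u : MonoFIM} (hu : u ∈ G n 1) :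
    lam (xi n 1 u) = lam u ∧ rho (xi n 1 u) = rho u - n ∧ proj (xi n 1 u) = proj u - n := by
  have h1 : (n : ℤ) ≤ proj u := hu
  have h2 : proj u ≤ rho u := (munnTree u).pt_le_right
  have h3 : lam u ≤ 0 := (munnTree u).left_le_zero
  have h := munnTree_ofSegment ⟨lam u, proj u - n, rho u - n, by omega, by omega, by omega,
    by omega⟩
  exact ⟨congrArg (·.left) h, congrArg (·.right) h, congrArg (·.pt) h⟩

theorem xi_two_spec {n : ℕ} {u : MonoFIM} (hu : u ∈ G n 2) :
    lam (xi n 2 u) = lam u ∧ rho (xi n 2 u) = rho u - n ∧ proj (xi n 2 u) = proj u := by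
  obtain ⟨h1, h2⟩ := hu
  have h3 : lam u ≤ 0 := (munnTree u).left_le_zero
  have h := munnTree_ofSegment ⟨lam u, proj u, rho u - n, by omega, by omega, by omega,
    by omega⟩
  exact ⟨congrArg (·.left) h, congrArg (·.right) h, congrArg (·.pt) h⟩

end MonoFIM

/-- The rational subsets of a monoid: those obtained from finite subsets by finitely many unions,
products and stars. -/
inductive IsRationalSubset {M : Type*} [Monoid M] : Set M → Prop
  | finite {K : Set M} : K.Finite → IsRationalSubset K
  | union {K L : Set M} : IsRationalSubset K → IsRationalSubset L → IsRationalSubset (K ∪ L)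
  | mul {K L : Set M} : IsRationalSubset K → IsRationalSubset L → IsRationalSubset (K * L)
  | star {K : Set M} : IsRationalSubset K → IsRationalSubset (⋃ n : ℕ, K ^ n)

/-- A finite description `(q, I, T, E)` of a finite automaton over `{a, a⁻¹}` with vertex set
`{0, …, q - 1}`: the lists of initial vertices, of terminal vertices and of edges. -/
abbrev AutomatonCode : Type :=
  ℕ × List ℕ × List ℕ × List (ℕ × MonoFIM.Letter × ℕ)

namespace AutomatonCode

/-- The (nondeterministic, finite) automaton described by a code. List entries that mention a number
`≥ q` are not vertices and are ignored. -/
def toNFA (c : AutomatonCode) : NFA MonoFIM.Letter (Fin c.1) where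
  start := {p | (p : ℕ) ∈ c.2.1}
  accept := {p | (p : ℕ) ∈ c.2.2.1}
  step p x := {q | ((p : ℕ), x, (q : ℕ)) ∈ c.2.2.2}

/-- The subset `L(𝒜)θ` of `F` described by the automaton `𝒜`. -/
def subset (c : AutomatonCode) : Set MonoFIM :=
  {u | ∃ w : List MonoFIM.Letter, w ∈ c.toNFA.accepts ∧ MonoFIM.theta (FreeMonoid.ofList w) = u}

end AutomatonCode

/-!
The Munn tree of a word over `{a, a⁻¹}` is the trace of a walk on the integer line. So an element `u`
of `F` lies in the subset presented by an automaton `M` with `q` vertices if and only if `M` has an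
accepting walk inside `[uλ, uρ]` from `0` to `uπ` which visits both ends `uλ` and `uρ`
(`AutomatonCode.mem_subset_iff`). Such a walk is composed of walks between the four points
`uλ`, `0`, `uπ`, `uρ`.

Let `[a, b]` be a segment which contains none of these points in its interior. A walk between points
outside of the interior of `[a, b]` is composed of moves outside and of excursions into `[a, b]` from
one end to the same or to the other end. Therefore `[a, b]` matters only through its passages, that
is, through a binary relation on the `2q` pairs of an end and a vertex of `M`, and it can be replaced
by any other segment with the same passages (`NFA.Walk.stretch`, `NFA.SpanningWalk.stretch`). The
same principle shows that the passages through a segment of length `m ≥ 1` determine those through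
the segments of length `m + 1`. As there are only `K = 2 ^ (2q * 2q)` relations, passages are
periodic in the length from `K + 1` on, with period `K!` (`NFA.passages_add_factorial`).

Take `n = K!` and `n' = K! + K + 1`. The three maps `ξ` of the statement shorten by `n` one of the
segments `[uλ, 0]`, `[0, uπ]`, `[uπ, uρ]`, whose length is at least `n'`, which gives the claim. Both
bounds depend on `q` only and are primitive recursive.

That every rational subset is presented by an automaton follows from the closure of regular languages
under products and stars, which is proved by counting left quotients, and from the
surjectivity of `θ`.
-/

/-! ### Excursions -/

open Relation in
/-- Cutting a path at its visits to `S`: if two steps of different kinds can follow each other only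
at a point of `S`, then a path between points of `S` is a chain of paths, each made of steps of one
kind only, between points of `S`. -/
theorem Relation.ReflTransGen.cut {ι C : Type*} {step : ι → C → C → Prop} {S : Set C}
    (h : ∀ i j x y z, i ≠ j → step i x y → step j y z → y ∈ S) {x y : C} (hx : x ∈ S) (hy : y ∈ S)
    (hxy : ReflTransGen (fun c d => ∃ i, step i c d) x y) :
    ReflTransGen (fun c d => c ∈ S ∧ d ∈ S ∧ ∃ i, ReflTransGen (step i) c d) x y := by
  have key : x = y ∨ ∃ z ∈ S, ReflTransGen (fun c d => c ∈ S ∧ d ∈ S ∧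
      ∃ i, ReflTransGen (step i) c d) x z ∧ ∃ i, TransGen (step i) z y := by
    clear hy
    induction hxy with
    | refl => exact .inl rfl
    | tail _ hstep ih =>
      obtain ⟨j, hj⟩ := hstep
      right
      rcases ih with rfl | ⟨z, hz, hxz, i, hi⟩
      · exact ⟨x, hx, .refl, j, .single hj⟩
      · rcases eq_or_ne i j with rfl | hij
        · exact ⟨z, hz, hxz, i, hi.tail hj⟩
        · obtain ⟨w, -, hw⟩ := TransGen.tail'_iff.1 hi
          have hy := h i j _ _ _ hij hw hj
          exact ⟨_, hy, hxz.tail ⟨hz, hy, i, hi.to_reflTransGen⟩, j, .single hj⟩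
  rcases key with rfl | ⟨z, hz, hxz, i, hi⟩
  · exact .refl
  · exact hxz.tail ⟨hz, hy, i, hi.to_reflTransGen⟩

namespace NFA

variable {σ : Type*} (M : NFA MonoFIM.Letter σ)

/-! ### Walks of an automaton on a segment of the integer line -/

/-- A transition of `M` read as a move on the integer line: the letter `a` moves one unit to the
right, `a⁻¹` one unit to the left. Both ends of the move have to lie in `[l, r]`. -/
def WalkStep (l r : ℤ) (c d : ℤ × σ) : Prop :=
  c.1 ∈ Set.Icc l r ∧ d.1 ∈ Set.Icc l r ∧
    ∃ b : Bool, d.1 = c.1 + (if b then 1 else -1) ∧ d.2 ∈ M.step c.2 ((), b)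

/-- Walks of `M` inside `[l, r]` between pairs of a position and a state. The empty walk is allowed
at every position, even outside `[l, r]`. -/
def Walk (l r : ℤ) : ℤ × σ → ℤ × σ → Prop := Relation.ReflTransGen (M.WalkStep l r)

variable {M}

theorem WalkStep.mono {l r l' r' : ℤ} (hl : l' ≤ l) (hr : r ≤ r') {c d : ℤ × σ}
    (h : M.WalkStep l r c d) : M.WalkStep l' r' c d :=
  ⟨Set.Icc_subset_Icc hl hr h.1, Set.Icc_subset_Icc hl hr h.2.1, h.2.2⟩

theorem Walk.mono {l r l' r' : ℤ} (hl : l' ≤ l) (hr : r ≤ r') {c d : ℤ × σ}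
    (h : M.Walk l r c d) : M.Walk l' r' c d :=
  Relation.ReflTransGen.mono (fun _ _ => WalkStep.mono hl hr) _ _ h

theorem Walk.add_right {l r x y : ℤ} {s t : σ} (k : ℤ) (h : M.Walk l r (x, s) (y, t)) :
    M.Walk (l + k) (r + k) (x + k, s) (y + k, t) := by
  refine Relation.ReflTransGen.lift (fun c : ℤ × σ => (c.1 + k, c.2)) ?_ _ _ h
  rintro ⟨c, s⟩ ⟨d, t⟩ ⟨hc, hd, b, hb, hst⟩
  simp only [Set.mem_Icc] at *
  exact ⟨⟨by dsimp; omega, by dsimp; omega⟩, ⟨by dsimp; omega, by dsimp; omega⟩, b,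
    by dsimp; omega, hst⟩

/-- A walk that moves at all stays in its segment. -/
theorem Walk.eq_or_mem {l r : ℤ} {c d : ℤ × σ} (h : M.Walk l r c d) :
    c = d ∨ c.1 ∈ Set.Icc l r ∧ d.1 ∈ Set.Icc l r := by
  induction h with
  | refl => exact .inl rfl
  | tail _ hs ih =>
    rcases ih with rfl | ⟨h1, -⟩
    · exact .inr ⟨hs.1, hs.2.1⟩
    · exact .inr ⟨h1, hs.2.1⟩

/-- The map of the integer line, except the inside of `[a, b]`, that replaces the
segment `[a, b]` by `[a', b']`. -/
def stretch (a b a' b' x : ℤ) : ℤ := if x ≤ a then x + (a' - a) else x + (b' - b)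

/-- A segment inside `[l, r]` may be replaced by another one which admits the same passages between
its ends. -/
theorem Walk.stretch {l r a b a' b' x y : ℤ} {s t : σ} (hab : a < b) (hab' : a' < b')
    (hla : l ≤ a) (hbr : b ≤ r)
    (hends : ∀ (e e' : Bool) (s t : σ),
      M.Walk a b (cond e b a, s) (cond e' b a, t) →
        M.Walk a' b' (cond e b' a', s) (cond e' b' a', t))
    (hx : x ∉ Set.Ioo a b) (hy : y ∉ Set.Ioo a b) (h : M.Walk l r (x, s) (y, t)) :
    M.Walk (l + (a' - a)) (r + (b' - b)) (NFA.stretch a b a' b' x, s)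
      (NFA.stretch a b a' b' y, t) := by
  -- the steps inside `[a, b]` and those outside of its interior
  let step : Bool → ℤ × σ → ℤ × σ → Prop := fun i c d =>
    if i then M.WalkStep a b c d
    else M.WalkStep l r c d ∧ (c.1 ≤ a ∧ d.1 ≤ a ∨ b ≤ c.1 ∧ b ≤ d.1)
  have hcut : Relation.ReflTransGen (fun c d => ∃ i, step i c d) (x, s) (y, t) := by
    refine Relation.ReflTransGen.mono ?_ _ _ h
    rintro ⟨c, s⟩ ⟨d, t⟩ hcd
    by_cases ho : c ≤ a ∧ d ≤ a ∨ b ≤ c ∧ b ≤ d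
    · exact ⟨false, hcd, ho⟩
    · refine ⟨true, ?_⟩
      obtain ⟨hc, hd, e, he, hst⟩ := hcd
      have : d = c + 1 ∨ d = c - 1 := by
        cases e
        · right; simpa [sub_eq_add_neg] using he
        · left; simpa using he
      exact ⟨⟨by dsimp; omega, by dsimp; omega⟩, ⟨by dsimp; omega, by dsimp; omega⟩, e, he, hst⟩
  have hswitch : ∀ i j c d f, i ≠ j → step i c d → step j d f →
      d ∈ {c : ℤ × σ | c.1 ∉ Set.Ioo a b} := by
    rintro (_ | _) (_ | _) c d f hij h1 h2
    · exact absurd rfl hij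
    · obtain ⟨-, h3⟩ := h1
      simp only [Set.mem_ofPred_eq, Set.mem_Ioo]; omega
    · obtain ⟨-, h3⟩ := h2
      simp only [Set.mem_ofPred_eq, Set.mem_Ioo]; omega
    · exact absurd rfl hij
  refine Relation.ReflTransGen.lift' (fun c : ℤ × σ => (NFA.stretch a b a' b' c.1, c.2)) ?_ _ _
    (Relation.ReflTransGen.cut hswitch hx hy hcut)
  rintro ⟨c, s⟩ ⟨d, t⟩ ⟨hc, hd, i, hi⟩
  cases i
  · refine Relation.ReflTransGen.lift (fun c : ℤ × σ => (NFA.stretch a b a' b' c.1, c.2)) ?_ _ _ hi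
    rintro ⟨c, s⟩ ⟨d, t⟩ ⟨⟨⟨h1, h2⟩, ⟨h3, h4⟩, e, he, hst⟩, ho⟩
    dsimp only at *
    refine ⟨?_, ?_, e, ?_, hst⟩ <;> simp only [NFA.stretch, Set.mem_Icc] <;>
      split_ifs at * <;> omega
  · have hw : M.Walk a b (c, s) (d, t) := hi
    rcases hw.eq_or_mem with heq | ⟨hc', hd'⟩
    · rw [heq]
    · have hend : ∀ z, z ∉ Set.Ioo a b → z ∈ Set.Icc a b →
          ∃ e : Bool, z = cond e b a ∧ NFA.stretch a b a' b' z = cond e b' a' := by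
        intro z h1 h2
        simp only [Set.mem_Ioo, Set.mem_Icc] at h1 h2
        by_cases hz : z = a
        · exact ⟨false, hz, by simp [NFA.stretch, hz]⟩
        · refine ⟨true, by simp only [cond_true]; omega, ?_⟩
          simp only [NFA.stretch, cond_true]; split_ifs <;> omega
      obtain ⟨e, he, he1⟩ := hend c hc hc'
      obtain ⟨f, hf, hf1⟩ := hend d hd hd'
      rw [he, hf] at hw
      have := hends e f s t hw
      change M.Walk _ _ (NFA.stretch a b a' b' c, s) (NFA.stretch a b a' b' d, t)
      rw [he1, hf1]
      exact this.mono (by omega) (by omega)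

/-! ### Passages through a segment are ultimately periodic in its length -/

variable (M) in
/-- The passages of `M` through a segment of length `m`: the walks inside the segment between its
ends, the left end being `false` and the right end `true`. -/
def passages (m : ℕ) : Set ((Bool × σ) × (Bool × σ)) :=
  {p | M.Walk 0 m (cond p.1.1 (m : ℤ) 0, p.1.2) (cond p.2.1 (m : ℤ) 0, p.2.2)}

theorem walk_of_passages_eq {a b a' b' : ℤ} (hab : a ≤ b) (hab' : a' ≤ b')
    (h : M.passages (b - a).toNat = M.passages (b' - a').toNat) (e e' : Bool) (s t : σ)
    (hw : M.Walk a b (cond e b a, s) (cond e' b a, t)) :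
    M.Walk a' b' (cond e b' a', s) (cond e' b' a', t) := by
  have e1 : ((b - a).toNat : ℤ) = b - a := by omega
  have e2 : ((b' - a').toNat : ℤ) = b' - a' := by omega
  have e3 : ∀ e : Bool, cond e (b - a) 0 = cond e b a + -a := by
    rintro (_ | _)
    · exact (add_neg_cancel a).symm
    · exact sub_eq_add_neg b a
  have e4 : ∀ e : Bool, cond e b' a' = cond e (b' - a') 0 + a' := by
    rintro (_ | _)
    · exact (zero_add a').symm
    · exact (sub_add_cancel b' a').symm
  have h1 : ((e, s), (e', t)) ∈ M.passages (b - a).toNat := by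
    simp only [passages, Set.mem_ofPred_eq, e1, e3]
    rw [← add_neg_cancel a, sub_eq_add_neg]
    exact hw.add_right (-a)
  rw [h] at h1
  simp only [passages, Set.mem_ofPred_eq, e2] at h1
  rw [e4 e, e4 e']
  convert h1.add_right a' using 1
  · exact (zero_add a').symm
  · exact (sub_add_cancel b' a').symm

/-- The passages through a segment determine those through the segment that is longer by one. -/
theorem passages_succ_subset {m k : ℕ} (hm : 1 ≤ m) (hk : 1 ≤ k)
    (h : M.passages m = M.passages k) : M.passages (m + 1) ⊆ M.passages (k + 1) := by
  rintro ⟨⟨e, s⟩, ⟨e', t⟩⟩ hw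
  simp only [passages, Set.mem_ofPred_eq] at hw ⊢
  have hends := walk_of_passages_eq (M := M) (a := 0) (b := m) (a' := 0) (b' := k)
    (by omega) (by omega) (by simpa using h)
  have hs : ∀ e : Bool, NFA.stretch 0 m 0 k (cond e ((m + 1 : ℕ) : ℤ) 0) =
      cond e ((k + 1 : ℕ) : ℤ) 0 := by
    rintro (_ | _)
    · simp [NFA.stretch]
    · simp only [NFA.stretch, cond_true]; split_ifs <;> omega
  have hmem : ∀ e : Bool, cond e ((m + 1 : ℕ) : ℤ) 0 ∉ Set.Ioo (0 : ℤ) m := by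
    rintro (_ | _) <;> simp
  have := hw.stretch (a := 0) (b := m) (a' := 0) (b' := k) (by omega) (by omega) le_rfl
    (by omega) hends (hmem e) (hmem e')
  rw [hs, hs] at this
  convert this using 1
  push_cast; omega

theorem passages_succ {m k : ℕ} (hm : 1 ≤ m) (hk : 1 ≤ k)
    (h : M.passages m = M.passages k) : M.passages (m + 1) = M.passages (k + 1) :=
  (passages_succ_subset hm hk h).antisymm (passages_succ_subset hk hm h.symm)

end NFA

/-- A sequence in a set of at most `K` elements, every term of which determines the next one, has
period `K!` from its `K`-th term on. -/
theorem Function.add_factorial_eq_of_card_le {α : Type*} [Fintype α] {g : ℕ → α} {K : ℕ}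
    (hK : Fintype.card α ≤ K) (hg : ∀ i j, g i = g j → g (i + 1) = g (j + 1)) {m : ℕ}
    (hm : K ≤ m) : g (m + K.factorial) = g m := by
  obtain ⟨i, j, hij, hgij⟩ : ∃ i j : Fin (K + 1), i < j ∧ g i = g j := by
    obtain ⟨i, j, hne, he⟩ := Fintype.exists_ne_map_eq_of_card_lt (fun i : Fin (K + 1) => g i)
      (by simpa using Nat.lt_succ_of_le hK)
    rcases lt_or_gt_of_ne hne with h | h
    · exact ⟨i, j, h, he⟩
    · exact ⟨j, i, h, he.symm⟩
  have hij' : (i : ℕ) < j := hij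
  have hj := j.is_lt
  have shift : ∀ t, g (i + t) = g (j + t) := by
    intro t
    induction t with
    | zero => exact hgij
    | succ t ih => exact hg _ _ ih
  have period : ∀ k, g (m + (j - i) * k) = g m := by
    intro k
    induction k with
    | zero => rfl
    | succ k ih =>
      rw [← ih]
      have := shift (m + (j - i) * k - i)
      rw [show (i : ℕ) + (m + (j - i) * k - i) = m + (j - i) * k by omega] at this
      rw [this]
      congr 1
      rw [mul_add]; omega
  obtain ⟨k, hk⟩ : (j - i : ℕ) ∣ K.factorial := Nat.dvd_factorial (by omega) (by omega)
  rw [hk, period]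

namespace NFA

variable {σ : Type*} {M : NFA MonoFIM.Letter σ}

theorem passages_add_factorial [Fintype σ] {m : ℕ}
    (hm : 2 ^ ((2 * Fintype.card σ) * (2 * Fintype.card σ)) + 1 ≤ m) :
    M.passages (m + (2 ^ ((2 * Fintype.card σ) * (2 * Fintype.card σ))).factorial) =
      M.passages m := by
  obtain ⟨m, rfl⟩ := Nat.exists_eq_add_of_le' (Nat.one_le_of_lt hm)
  have := Function.add_factorial_eq_of_card_le (g := fun i => M.passages (i + 1))
    (K := 2 ^ ((2 * Fintype.card σ) * (2 * Fintype.card σ))) (m := m) (by classical simp)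
    (fun i j => passages_succ (by omega) (by omega)) (by omega)
  rw [add_right_comm]
  exact this

/-! ### Munn trees of accepted words -/

variable (M) in
/-- `M` has an accepting walk inside `[l, r]` from `0` to `p` which visits both `l` and `r`, in
either order. -/
def SpanningWalk (l p r : ℤ) : Prop :=
  ∃ s ∈ M.start, ∃ t ∈ M.accept, ∃ s₁ s₂,
    M.Walk l r (0, s) (l, s₁) ∧ M.Walk l r (l, s₁) (r, s₂) ∧ M.Walk l r (r, s₂) (p, t) ∨
    M.Walk l r (0, s) (r, s₁) ∧ M.Walk l r (r, s₁) (l, s₂) ∧ M.Walk l r (l, s₂) (p, t)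

/-- Accepting spanning walks survive the replacement of a segment by one with the same passages,
provided that the initial vertex, the terminal vertex and the two ends of the line are not inside
that segment. -/
theorem SpanningWalk.stretch {l p r a b a' b' : ℤ} (hab : a < b) (hab' : a' < b')
    (hrel : M.passages (b - a).toNat = M.passages (b' - a').toNat)
    (hla : l ≤ a) (hbr : b ≤ r) (h0 : (0 : ℤ) ∉ Set.Ioo a b) (hp : p ∉ Set.Ioo a b)
    (h0' : NFA.stretch a b a' b' 0 = 0) (h : M.SpanningWalk l p r) :
    M.SpanningWalk (NFA.stretch a b a' b' l) (NFA.stretch a b a' b' p)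
      (NFA.stretch a b a' b' r) := by
  have hends := walk_of_passages_eq (M := M) hab.le hab'.le hrel
  have hl : l ∉ Set.Ioo a b := by simp only [Set.mem_Ioo]; omega
  have hr : r ∉ Set.Ioo a b := by simp only [Set.mem_Ioo]; omega
  have el : l + (a' - a) = NFA.stretch a b a' b' l := by rw [NFA.stretch, if_pos hla]
  have er : r + (b' - b) = NFA.stretch a b a' b' r := by rw [NFA.stretch, if_neg (by omega)]
  have key : ∀ {x y : ℤ} {s t : σ}, x ∉ Set.Ioo a b → y ∉ Set.Ioo a b →
      M.Walk l r (x, s) (y, t) → M.Walk (NFA.stretch a b a' b' l) (NFA.stretch a b a' b' r)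
        (NFA.stretch a b a' b' x, s) (NFA.stretch a b a' b' y, t) := by
    intro x y s t hx hy hw
    rw [← el, ← er]
    exact hw.stretch hab hab' hla hbr hends hx hy
  obtain ⟨s, hs, t, ht, s₁, s₂, h | h⟩ := h
  · refine ⟨s, hs, t, ht, s₁, s₂, .inl ⟨?_, key hl hr h.2.1, key hr hp h.2.2⟩⟩
    have := key h0 hl h.1
    rwa [h0'] at this
  · refine ⟨s, hs, t, ht, s₁, s₂, .inr ⟨?_, key hr hl h.2.1, key hl hp h.2.2⟩⟩
    have := key h0 hr h.1
    rwa [h0'] at this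

end NFA

namespace MunnSegment

/-- The Munn tree of a list of letters. -/
def ofList (w : List MonoFIM.Letter) : MunnSegment := ofWord (FreeMonoid.ofList w)

theorem ofList_nil : ofList [] = 1 := map_one ofWord

theorem ofList_append (v w : List MonoFIM.Letter) : ofList (v ++ w) = ofList v * ofList w := by
  rw [ofList, FreeMonoid.ofList_append, map_mul]; rfl

theorem ofList_singleton (x : MonoFIM.Letter) : ofList [x] = ofLetter x :=
  FreeMonoid.lift_eval_of _ _

theorem ofList_cons (x : MonoFIM.Letter) (w : List MonoFIM.Letter) :
    ofList (x :: w) = ofLetter x * ofList w := by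
  rw [← List.singleton_append, ofList_append, ofList_singleton]

/-- A word has a prefix that ends at the left end of its Munn tree. -/
theorem exists_prefix_pt_eq_left (w : List MonoFIM.Letter) :
    ∃ u v, w = u ++ v ∧ (ofList u).pt = (ofList w).left := by
  induction w with
  | nil => exact ⟨[], [], rfl, rfl⟩
  | cons x w ih =>
    obtain ⟨u, v, rfl, h⟩ := ih
    have h1 := (ofList (u ++ v)).left_le_zero
    by_cases h0 : (ofList (x :: (u ++ v))).left = 0
    · exact ⟨[], _, rfl, by rw [h0]; rfl⟩
    · refine ⟨x :: u, v, rfl, ?_⟩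
      rw [ofList_cons, mul_left] at h0
      rw [ofList_cons, ofList_cons, mul_left, mul_pt, h]
      rcases x with ⟨_, _ | _⟩ <;> simp only [ofLetter] at h0 ⊢ <;> simp at h0 ⊢ <;> omega

/-- A word has a prefix that ends at the right end of its Munn tree. -/
theorem exists_prefix_pt_eq_right (w : List MonoFIM.Letter) :
    ∃ u v, w = u ++ v ∧ (ofList u).pt = (ofList w).right := by
  induction w with
  | nil => exact ⟨[], [], rfl, rfl⟩
  | cons x w ih =>
    obtain ⟨u, v, rfl, h⟩ := ih
    have h1 := (ofList (u ++ v)).zero_le_right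
    by_cases h0 : (ofList (x :: (u ++ v))).right = 0
    · exact ⟨[], _, rfl, by rw [h0]; rfl⟩
    · refine ⟨x :: u, v, rfl, ?_⟩
      rw [ofList_cons, mul_right] at h0
      rw [ofList_cons, ofList_cons, mul_right, mul_pt, h]
      rcases x with ⟨_, _ | _⟩ <;> simp only [ofLetter] at h0 ⊢ <;> simp at h0 ⊢ <;> omega

end MunnSegment

namespace NFA

open MunnSegment (ofList ofList_append ofList_cons ofList_nil ofList_singleton)

variable {σ : Type*} {M : NFA MonoFIM.Letter σ}

theorem mem_evalFrom_append {s t u : σ} {v w : List MonoFIM.Letter} (h1 : t ∈ M.evalFrom {s} v)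
    (h2 : u ∈ M.evalFrom {t} w) : u ∈ M.evalFrom {s} (v ++ w) := by
  rw [evalFrom_append, mem_evalFrom_iff_exists]
  exact ⟨t, h1, h2⟩

theorem exists_of_mem_evalFrom_append {s u : σ} {v w : List MonoFIM.Letter}
    (h : u ∈ M.evalFrom {s} (v ++ w)) : ∃ t ∈ M.evalFrom {s} v, u ∈ M.evalFrom {t} w := by
  rwa [evalFrom_append, mem_evalFrom_iff_exists] at h

/-- Reading a word is a walk inside the Munn tree of the word. -/
theorem walk_of_mem_evalFrom {l r x : ℤ} {s t : σ} {w : List MonoFIM.Letter}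
    (h : t ∈ M.evalFrom {s} w) (hl : l ≤ x + (ofList w).left) (hr : x + (ofList w).right ≤ r) :
    M.Walk l r (x, s) (x + (ofList w).pt, t) := by
  induction w generalizing s x with
  | nil =>
    obtain rfl : t = s := by simpa using h
    simp only [ofList_nil, MunnSegment.one_pt, add_zero]
    exact .refl
  | cons a w ih =>
    rw [evalFrom_cons, stepSet_singleton, mem_evalFrom_iff_exists] at h
    obtain ⟨s', hs', ht⟩ := h
    rw [ofList_cons, MunnSegment.mul_left] at hl
    rw [ofList_cons, MunnSegment.mul_right] at hr
    have h1 := (ofList w).left_le_zero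
    have h2 := (ofList w).zero_le_right
    have e : x + (ofList (a :: w)).pt = x + (MunnSegment.ofLetter a).pt + (ofList w).pt := by
      rw [ofList_cons, MunnSegment.mul_pt, add_assoc]
    rw [e]
    refine Relation.ReflTransGen.head ?_
      (ih (x := x + (MunnSegment.ofLetter a).pt) ht (by omega) (by omega))
    rcases a with ⟨⟨⟩, b⟩
    refine ⟨?_, ?_, b, ?_, hs'⟩ <;> simp only [Set.mem_Icc] <;> cases b <;>
      simp [MunnSegment.ofLetter] at hl hr ⊢ <;> omega

theorem exists_word_of_walk {l r x y : ℤ} {s t : σ} (hx : x ∈ Set.Icc l r)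
    (h : M.Walk l r (x, s) (y, t)) : ∃ w : List MonoFIM.Letter, t ∈ M.evalFrom {s} w ∧
      l ≤ x + (ofList w).left ∧ x + (ofList w).right ≤ r ∧ x + (ofList w).pt = y := by
  obtain ⟨hx1, hx2⟩ := hx
  suffices ∀ d : ℤ × σ, M.Walk l r (x, s) d → ∃ w : List MonoFIM.Letter,
      d.2 ∈ M.evalFrom {s} w ∧ l ≤ x + (ofList w).left ∧ x + (ofList w).right ≤ r ∧
        x + (ofList w).pt = d.1 from this _ h
  intro d hd
  induction hd with
  | refl =>
    refine ⟨[], by simp, ?_, ?_, ?_⟩ <;>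
      simp [ofList_nil, MunnSegment.one_left, MunnSegment.one_right, MunnSegment.one_pt, hx1, hx2]
  | @tail c d _ hs ih =>
    obtain ⟨w, h1, h2, h3, h4⟩ := ih
    obtain ⟨⟨hc1, hc2⟩, ⟨hd1, hd2⟩, b, hb, hst⟩ := hs
    refine ⟨w ++ [((), b)], mem_evalFrom_append h1 (by simpa using hst), ?_, ?_, ?_⟩ <;>
      rw [ofList_append, ofList_singleton] <;>
      simp only [MunnSegment.mul_left, MunnSegment.mul_right, MunnSegment.mul_pt] <;>
      cases b <;> simp [MunnSegment.ofLetter] at hb ⊢ <;> omega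

/-- The Munn trees of the accepted words are the spans of the accepting walks. -/
theorem exists_mem_accepts_iff_spanningWalk (T : MunnSegment) :
    (∃ w ∈ M.accepts, ofList w = T) ↔ M.SpanningWalk T.left T.pt T.right := by
  constructor
  · rintro ⟨w, ⟨t, ht, hw⟩, rfl⟩
    obtain ⟨s, hs, hw⟩ := mem_evalFrom_iff_exists.1 hw
    -- a factorization of `w` into three factors cuts the walk that reads `w` into three walks
    have key : ∀ w₁ w₂ w₃ : List MonoFIM.Letter, w = w₁ ++ w₂ ++ w₃ → ∃ s₁ s₂,
        M.Walk (ofList w).left (ofList w).right (0, s) ((ofList w₁).pt, s₁) ∧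
        M.Walk (ofList w).left (ofList w).right ((ofList w₁).pt, s₁)
          ((ofList (w₁ ++ w₂)).pt, s₂) ∧
        M.Walk (ofList w).left (ofList w).right ((ofList (w₁ ++ w₂)).pt, s₂)
          ((ofList w).pt, t) := by
      rintro w₁ w₂ w₃ rfl
      obtain ⟨s₂, hw', hw₃⟩ := exists_of_mem_evalFrom_append hw
      obtain ⟨s₁, hw₁, hw₂⟩ := exists_of_mem_evalFrom_append hw'
      have b1 : (ofList (w₁ ++ w₂ ++ w₃)).left = min (min (ofList w₁).left
          ((ofList w₁).pt + (ofList w₂).left)) ((ofList w₁).pt + (ofList w₂).pt +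
          (ofList w₃).left) := by
        rw [ofList_append, ofList_append]; rfl
      have b2 : (ofList (w₁ ++ w₂ ++ w₃)).right = max (max (ofList w₁).right
          ((ofList w₁).pt + (ofList w₂).right)) ((ofList w₁).pt + (ofList w₂).pt +
          (ofList w₃).right) := by
        rw [ofList_append, ofList_append]; rfl
      have b3 : (ofList (w₁ ++ w₂)).pt = (ofList w₁).pt + (ofList w₂).pt := by
        rw [ofList_append]; rfl
      have b4 : (ofList (w₁ ++ w₂ ++ w₃)).pt = (ofList (w₁ ++ w₂)).pt + (ofList w₃).pt := by
        rw [ofList_append]; rfl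
      refine ⟨s₁, s₂, ?_, ?_, ?_⟩
      · have := walk_of_mem_evalFrom (x := 0) hw₁ (l := (ofList (w₁ ++ w₂ ++ w₃)).left)
          (r := (ofList (w₁ ++ w₂ ++ w₃)).right) (by omega) (by omega)
        rwa [zero_add] at this
      · rw [b3]
        exact walk_of_mem_evalFrom hw₂ (by omega) (by omega)
      · rw [b4]
        exact walk_of_mem_evalFrom hw₃ (by omega) (by omega)
    obtain ⟨u, v, huv, hu⟩ := MunnSegment.exists_prefix_pt_eq_left w
    have hright : (ofList w).right = max (ofList u).right ((ofList u).pt + (ofList v).right) := by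
      rw [huv, ofList_append]; rfl
    rcases le_total ((ofList u).pt + (ofList v).right) (ofList u).right with hle | hle
    · obtain ⟨u₁, u₂, rfl, hu₁⟩ := MunnSegment.exists_prefix_pt_eq_right u
      obtain ⟨s₁, s₂, h1, h2, h3⟩ := key u₁ u₂ v huv
      rw [hu] at h2 h3
      rw [hu₁, ← max_eq_left hle, ← hright] at h1 h2
      exact ⟨s, hs, t, ht, s₁, s₂, .inr ⟨h1, h2, h3⟩⟩
    · obtain ⟨v₁, v₂, rfl, hv₁⟩ := MunnSegment.exists_prefix_pt_eq_right v
      obtain ⟨s₁, s₂, h1, h2, h3⟩ := key u v₁ v₂ (by rw [huv, List.append_assoc])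
      have e : (ofList (u ++ v₁)).pt = (ofList w).right := by
        rw [ofList_append, MunnSegment.mul_pt, hv₁, hright, max_eq_right hle]
      rw [e] at h2 h3
      rw [hu] at h1 h2
      exact ⟨s, hs, t, ht, s₁, s₂, .inl ⟨h1, h2, h3⟩⟩
  · have i1 := T.left_le_zero
    have i2 := T.zero_le_right
    have i3 := T.left_le_pt
    have i4 := T.pt_le_right
    have key : ∀ {x y : ℤ} {s t s₁ s₂ : σ}, s ∈ M.start → t ∈ M.accept →
        x ∈ Set.Icc T.left T.right → y ∈ Set.Icc T.left T.right →
        (x = T.left ∧ y = T.right ∨ x = T.right ∧ y = T.left) →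
        M.Walk T.left T.right (0, s) (x, s₁) → M.Walk T.left T.right (x, s₁) (y, s₂) →
        M.Walk T.left T.right (y, s₂) (T.pt, t) → ∃ w ∈ M.accepts, ofList w = T := by
      intro x y s t s₁ s₂ hs ht hx hy hxy h1 h2 h3
      obtain ⟨w₁, a1, a2, a3, a4⟩ := exists_word_of_walk ⟨i1, i2⟩ h1
      obtain ⟨w₂, b1, b2, b3, b4⟩ := exists_word_of_walk hx h2
      obtain ⟨w₃, c1, c2, c3, c4⟩ := exists_word_of_walk hy h3
      refine ⟨w₁ ++ w₂ ++ w₃, ⟨t, ht, mem_evalFrom_iff_exists.2 ⟨s, hs,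
        mem_evalFrom_append (mem_evalFrom_append a1 b1) c1⟩⟩, ?_⟩
      have d1 := (ofList w₁).left_le_pt
      have d2 := (ofList w₁).pt_le_right
      have d3 := (ofList w₂).left_le_pt
      have d4 := (ofList w₂).pt_le_right
      rw [ofList_append, ofList_append]
      ext <;> simp only [MunnSegment.mul_left, MunnSegment.mul_right, MunnSegment.mul_pt] <;> omega
    rintro ⟨s, hs, t, ht, s₁, s₂, ⟨h1, h2, h3⟩ | ⟨h1, h2, h3⟩⟩
    · exact key hs ht ⟨le_rfl, by omega⟩ ⟨by omega, le_rfl⟩ (.inl ⟨rfl, rfl⟩) h1 h2 h3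
    · exact key hs ht ⟨by omega, le_rfl⟩ ⟨le_rfl, by omega⟩ (.inr ⟨rfl, rfl⟩) h1 h2 h3

end NFA

theorem AutomatonCode.mem_subset_iff (c : AutomatonCode) (u : MonoFIM) :
    u ∈ c.subset ↔
      c.toNFA.SpanningWalk (MonoFIM.lam u) (MonoFIM.proj u) (MonoFIM.rho u) := by
  refine Iff.trans ?_ (NFA.exists_mem_accepts_iff_spanningWalk (MonoFIM.munnTree u))
  exact exists_congr fun w => and_congr_right fun _ =>
    (MonoFIM.munnTree_injective.eq_iff (a := MonoFIM.theta (FreeMonoid.ofList w))).symm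

/-! ### Rational subsets are presented by automata -/

namespace Language

/-- A left quotient of `K * L` by `x` consists of the words that complete `x` inside the first
factor and of those that complete a suffix of `x` inside the second factor. So it is given by a left
quotient of `K` and a set of left quotients of `L`. -/
theorem IsRegular.mul {α : Type*} {K L : Language α} (hK : K.IsRegular) (hL : L.IsRegular) :
    (K * L).IsRegular := by
  rw [isRegular_iff_finite_range_leftQuotient] at *
  refine (Set.Finite.image2 (fun (A : Language α) (S : Set (Language α)) => A * L ⊔ sSup S) hK
    hL.finite_subsets).subset ?_
  rintro _ ⟨x, rfl⟩
  refine ⟨K.leftQuotient x, ⟨x, rfl⟩, {A | ∃ y ∈ K, ∃ z, x = y ++ z ∧ L.leftQuotient z = A},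
    ?_, ?_⟩
  · rintro _ ⟨y, -, z, -, rfl⟩
    exact ⟨z, rfl⟩
  · ext w
    rw [mem_leftQuotient]
    change (w ∈ K.leftQuotient x * L ∨ ∃ A, (∃ y ∈ K, ∃ z, x = y ++ z ∧ L.leftQuotient z = A) ∧
      w ∈ A) ↔ _
    simp only [mem_mul, mem_leftQuotient]
    constructor
    · rintro (⟨u, hu, v, hv, rfl⟩ | ⟨_, ⟨y, hy, z, rfl, rfl⟩, hw⟩)
      · exact ⟨x ++ u, hu, v, hv, List.append_assoc _ _ _⟩
      · exact ⟨y, hy, z ++ w, hw, (List.append_assoc _ _ _).symm⟩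
    · rintro ⟨u, hu, v, hv, huv⟩
      rcases List.append_eq_append_iff.1 huv with ⟨z, rfl, rfl⟩ | ⟨z, rfl, rfl⟩
      · exact .inr ⟨_, ⟨u, hu, z, rfl, rfl⟩, hv⟩
      · exact .inl ⟨z, hu, v, hv, rfl⟩

open Computability in
/-- A left quotient of `K∗` by a nonempty word `x` consists of the words that complete a suffix of
`x` inside `K`, followed by a word of `K∗`. So it is given by a set of left quotients of `K`. -/
theorem IsRegular.kstar {α : Type*} {K : Language α} (hK : K.IsRegular) : K∗.IsRegular := by
  rw [isRegular_iff_finite_range_leftQuotient] at *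
  refine ((hK.finite_subsets.image fun S : Set (Language α) => sSup S * K∗).insert
    K∗).subset ?_
  rintro _ ⟨x, rfl⟩
  rcases eq_or_ne x [] with rfl | hx
  · exact .inl rfl
  refine .inr ⟨{A | ∃ y ∈ K∗, ∃ z, x = y ++ z ∧ K.leftQuotient z = A}, ?_, ?_⟩
  · rintro _ ⟨y, -, z, -, rfl⟩
    exact ⟨z, rfl⟩
  · have hmul : ∀ u ∈ K∗, ∀ v ∈ K∗, u ++ v ∈ K∗ := by
      intro u hu v hv
      rw [← kstar_mul_kstar K]
      exact ⟨u, hu, v, hv, rfl⟩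
    have hle : ∀ u ∈ K, u ∈ K∗ := fun u hu => (le_kstar : K ≤ K∗) hu
    ext w
    rw [mem_leftQuotient, mem_mul]
    constructor
    · rintro ⟨u, ⟨_, ⟨y, hy, z, rfl, rfl⟩, hu⟩, v, hv, rfl⟩
      have := hmul _ (hmul y hy _ (hle _ hu)) v hv
      simpa [List.append_assoc] using this
    · intro h
      obtain ⟨S, hS, hSK⟩ := mem_kstar.1 h
      suffices ∃ u, (∃ y ∈ K∗, ∃ z, x = y ++ z ∧ z ++ u ∈ K) ∧ ∃ v ∈ K∗, u ++ v = w by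
        obtain ⟨u, ⟨y, hy, z, hx, hu⟩, v, hv⟩ := this
        exact ⟨u, ⟨_, ⟨y, hy, z, hx, rfl⟩, hu⟩, v, hv⟩
      clear h
      induction S generalizing x with
      | nil => simp at hS; exact absurd hS.1 hx
      | cons k S ih =>
        have hk : k ∈ K := hSK k (by simp)
        have hSK' : ∀ y ∈ S, y ∈ K := fun y hy => hSK y (by simp [hy])
        rw [List.flatten_cons] at hS
        rcases List.append_eq_append_iff.1 hS with ⟨z, rfl, rfl⟩ | ⟨z, rfl, hz⟩
        · exact ⟨z, ⟨[], nil_mem_kstar K, x, rfl, hk⟩, S.flatten,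
            mem_kstar.2 ⟨S, rfl, hSK'⟩, rfl⟩
        · rcases eq_or_ne z [] with rfl | hz0
          · exact ⟨[], ⟨[], nil_mem_kstar K, k ++ [], rfl, by simpa using hk⟩, w,
              mem_kstar.2 ⟨S, by simpa using hz.symm, hSK'⟩, rfl⟩
          · obtain ⟨u, ⟨y, hy, z', rfl, hu⟩, v, hv⟩ := ih z hz0 hz.symm hSK'
            exact ⟨u, ⟨k ++ y, hmul k (hle k hk) y hy, z', (List.append_assoc _ _ _).symm, hu⟩,
              v, hv⟩

theorem IsRegular.of_finite {α : Type*} {L : Language α} (h : Set.Finite {w | w ∈ L}) :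
    L.IsRegular := by
  rw [isRegular_iff_finite_range_leftQuotient]
  have hsuf : (⋃ w ∈ {w | w ∈ L}, {y : List α | y <:+ w}).Finite := by
    refine h.biUnion fun w _ => (List.finite_toSet w.tails).subset fun y hy => ?_
    exact (List.mem_tails _ _).2 hy
  refine Set.Finite.subset (s := {S : Set (List α) | S ⊆ ⋃ w ∈ {w | w ∈ L}, {y : List α | y <:+ w}})
    hsuf.finite_subsets ?_
  rintro _ ⟨x, rfl⟩ y hy
  exact Set.mem_biUnion (show x ++ y ∈ L from hy) (List.suffix_append x y)

end Language

namespace MonoFIM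

/-- The subset of `F` presented by a language. -/
def imageTheta (R : Language Letter) : Set MonoFIM :=
  {u | ∃ w ∈ R, theta (FreeMonoid.ofList w) = u}

theorem imageTheta_mul (R S : Language Letter) :
    imageTheta (R * S) = imageTheta R * imageTheta S := by
  ext u
  rw [Set.mem_mul]
  constructor
  · rintro ⟨_, ⟨v, hv, w, hw, rfl⟩, rfl⟩
    exact ⟨_, ⟨v, hv, rfl⟩, _, ⟨w, hw, rfl⟩, (map_mul theta _ _).symm⟩
  · rintro ⟨_, ⟨v, hv, rfl⟩, _, ⟨w, hw, rfl⟩, rfl⟩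
    exact ⟨_, ⟨v, hv, w, hw, rfl⟩, map_mul theta _ _⟩

theorem imageTheta_one : imageTheta 1 = 1 := by
  ext u
  constructor
  · rintro ⟨w, rfl, rfl⟩
    exact map_one theta
  · rintro rfl
    exact ⟨[], rfl, map_one theta⟩

theorem imageTheta_pow (R : Language Letter) (n : ℕ) :
    imageTheta (R ^ n) = imageTheta R ^ n := by
  induction n with
  | zero => rw [pow_zero, pow_zero, imageTheta_one]
  | succ n ih => rw [pow_succ, pow_succ, imageTheta_mul, ih]

open Computability in
theorem imageTheta_kstar (R : Language Letter) : imageTheta R∗ = ⋃ n : ℕ, imageTheta R ^ n := by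
  ext u
  simp only [Set.mem_iUnion, ← imageTheta_pow, Language.kstar_eq_iSup_pow]
  constructor
  · rintro ⟨w, hw, rfl⟩
    obtain ⟨n, hn⟩ := Language.mem_iSup.1 hw
    exact ⟨n, w, hn, rfl⟩
  · rintro ⟨n, w, hn, rfl⟩
    exact ⟨w, Language.mem_iSup.2 ⟨n, hn⟩, rfl⟩

end MonoFIM

open Computability in
/-- A rational subset of `F` is presented by a regular language. -/
theorem IsRationalSubset.exists_isRegular {L : Set MonoFIM} (hL : IsRationalSubset L) :
    ∃ R : Language MonoFIM.Letter, R.IsRegular ∧ MonoFIM.imageTheta R = L := by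
  induction hL with
  | @finite K hK =>
    -- choose one word over each element of `K`
    let w : MonoFIM → List MonoFIM.Letter := fun u =>
      (Function.surjInv MonoFIM.theta_surjective u).toList
    have hw : ∀ u, MonoFIM.theta (FreeMonoid.ofList (w u)) = u :=
      Function.surjInv_eq MonoFIM.theta_surjective
    refine ⟨w '' K, .of_finite (hK.image w), ?_⟩
    ext u
    constructor
    · rintro ⟨_, ⟨v, hv, rfl⟩, rfl⟩
      rwa [hw]
    · intro hu
      exact ⟨_, ⟨u, hu, rfl⟩, hw u⟩
  | union _ _ hK hL =>
    obtain ⟨R, hR, rfl⟩ := hK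
    obtain ⟨S, hS, rfl⟩ := hL
    refine ⟨R + S, hR.add hS, ?_⟩
    ext u
    constructor
    · rintro ⟨w, hw | hw, rfl⟩
      · exact .inl ⟨w, hw, rfl⟩
      · exact .inr ⟨w, hw, rfl⟩
    · rintro (⟨w, hw, rfl⟩ | ⟨w, hw, rfl⟩)
      · exact ⟨w, .inl hw, rfl⟩
      · exact ⟨w, .inr hw, rfl⟩
  | mul _ _ hK hL =>
    obtain ⟨R, hR, rfl⟩ := hK
    obtain ⟨S, hS, rfl⟩ := hL
    exact ⟨R * S, hR.mul hS, MonoFIM.imageTheta_mul R S⟩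
  | star _ hK =>
    obtain ⟨R, hR, rfl⟩ := hK
    exact ⟨R∗, hR.kstar, MonoFIM.imageTheta_kstar R⟩

/-- The code of a deterministic automaton with vertex set `Fin q`. -/
noncomputable def DFA.code {q : ℕ} (M : DFA MonoFIM.Letter (Fin q)) : AutomatonCode :=
  open Classical in
  (q, [(M.start : ℕ)], (Finset.univ.filter (· ∈ M.accept)).toList.map Fin.val,
    (Finset.univ (α := Fin q × MonoFIM.Letter)).toList.map
      fun p => ((p.1 : ℕ), p.2, (M.step p.1 p.2 : ℕ)))

theorem DFA.accepts_toNFA_code {q : ℕ} (M : DFA MonoFIM.Letter (Fin q)) :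
    M.code.toNFA.accepts = M.accepts := by
  have h1 : M.code.toNFA.start = M.toNFA.start := by
    refine Set.ext fun p : Fin q => ?_
    change (p : ℕ) ∈ [(M.start : ℕ)] ↔ p = M.start
    simp [Fin.ext_iff]
  have h2 : M.code.toNFA.accept = M.toNFA.accept := by
    refine Set.ext fun p : Fin q => ?_
    change (p : ℕ) ∈ List.map _ _ ↔ p ∈ M.accept
    simp [Fin.val_inj]
  have h3 : M.code.toNFA.step = M.toNFA.step := by
    refine funext fun p : Fin q => funext fun x => Set.ext fun s : Fin q => ?_
    change ((p : ℕ), x, (s : ℕ)) ∈ List.map _ _ ↔ s = M.step p x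
    simp [Fin.val_inj, eq_comm]
  have h : M.code.toNFA = M.toNFA := congr (congr (congrArg NFA.mk h3) h1) h2
  exact (congrArg (fun A : NFA MonoFIM.Letter (Fin q) => A.accepts) h).trans M.toNFA_correct

/-- Every rational subset of `F` is presented by an automaton. -/
theorem IsRationalSubset.exists_code {L : Set MonoFIM} (hL : IsRationalSubset L) :
    ∃ c : AutomatonCode, c.subset = L := by
  obtain ⟨R, ⟨σ, _, M, rfl⟩, rfl⟩ := hL.exists_isRegular
  refine ⟨(DFA.reindex (Fintype.equivFin σ) M).code, ?_⟩
  have h := (DFA.accepts_toNFA_code (DFA.reindex (Fintype.equivFin σ) M)).trans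
    (DFA.accepts_reindex M (Fintype.equivFin σ))
  rw [← h]
  rfl

/-! ### Computability of the bounds -/

theorem Primrec.nat_pow : Primrec₂ fun m n : ℕ => m ^ n :=
  Primrec₂.unpaired'.1 Nat.Primrec.pow

theorem Primrec.nat_factorial : Primrec Nat.factorial := by
  refine (Primrec.nat_rec₁ (f := fun n k => (n + 1) * k) 1
    (Primrec.nat_mul.comp₂ (Primrec.succ.comp₂ Primrec₂.left) Primrec₂.right)).of_eq fun n => ?_
  induction n with
  | zero => rfl
  | succ n ih => rw [Nat.factorial_succ, ← ih]

namespace AutomatonCode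

/-- A bound for the number of possible sets of passages through a segment: the number of binary
relations on the set of pairs of an end of the segment and a vertex of the automaton. -/
def passageBound (c : AutomatonCode) : ℕ := 2 ^ ((2 * c.1) * (2 * c.1))

/-- The length by which a long segment may be shortened. -/
def period (c : AutomatonCode) : ℕ := c.passageBound.factorial

/-- The length from which on a segment may be shortened. -/
def threshold (c : AutomatonCode) : ℕ := c.period + (c.passageBound + 1)

theorem primrec_passageBound : Primrec passageBound := by
  have h : Primrec fun c : AutomatonCode => 2 * c.1 :=
    Primrec.nat_mul.comp (Primrec.const 2) Primrec.fst
  exact Primrec.nat_pow.comp (Primrec.const 2) (Primrec.nat_mul.comp h h)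

theorem primrec_period : Primrec period := Primrec.nat_factorial.comp primrec_passageBound

theorem primrec_threshold : Primrec threshold :=
  Primrec.nat_add.comp primrec_period (Primrec.succ.comp primrec_passageBound)

theorem passages_eq (c : AutomatonCode) {d d' : ℤ} (h : d' = d - c.period)
    (hd : (c.threshold : ℤ) ≤ d) : c.toNFA.passages d.toNat = c.toNFA.passages d'.toNat := by
  have ht : c.threshold = c.period + (c.passageBound + 1) := rfl
  have hle : c.passageBound + 1 ≤ d'.toNat := by omega
  have e : d.toNat = d'.toNat + c.period := by omega
  rw [e]
  have := NFA.passages_add_factorial (M := c.toNFA) (m := d'.toNat)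
    (by simpa [passageBound] using hle)
  simpa [period, passageBound] using this

/-- Shortening a long segment by the period does not affect the existence of an accepting walk with
the given span. -/
theorem spanningWalk_iff_stretch (c : AutomatonCode) {l p r a b a' b' : ℤ}
    (hd : (c.threshold : ℤ) ≤ b - a) (h' : b' - a' = b - a - c.period)
    (hla : l ≤ a) (hbr : b ≤ r) (h0 : (0 : ℤ) ∉ Set.Ioo a b) (hp : p ∉ Set.Ioo a b)
    (h0' : NFA.stretch a b a' b' 0 = 0) :
    c.toNFA.SpanningWalk l p r ↔ c.toNFA.SpanningWalk (NFA.stretch a b a' b' l)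
      (NFA.stretch a b a' b' p) (NFA.stretch a b a' b' r) := by
  have ht : c.threshold = c.period + (c.passageBound + 1) := rfl
  have hpass := c.passages_eq h' hd
  -- the new segment still has length at least `passageBound + 1 > 0`, so that its two ends are
  -- distinct and the replacement can be inverted
  refine ⟨NFA.SpanningWalk.stretch (by omega) (by omega) hpass hla hbr h0 hp h0', fun h => ?_⟩
  have hinv : ∀ x, x ∉ Set.Ioo a b →
      NFA.stretch a' b' a b (NFA.stretch a b a' b' x) = x ∧
        NFA.stretch a b a' b' x ∉ Set.Ioo a' b' := by
    intro x hx
    simp only [Set.mem_Ioo] at hx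
    simp only [NFA.stretch, Set.mem_Ioo]
    split_ifs <;> omega
  have h1 := NFA.SpanningWalk.stretch (a := a') (b := b') (a' := a) (b' := b) (by omega) (by omega)
    hpass.symm (by simp only [NFA.stretch]; split_ifs; omega)
    (by simp only [NFA.stretch]; split_ifs <;> omega) (h0' ▸ (hinv 0 h0).2) (hinv p hp).2
    (by simpa only [h0'] using (hinv 0 h0).1) h
  rwa [(hinv p hp).1, (hinv l (by simp only [Set.mem_Ioo]; omega)).1,
    (hinv r (by simp only [Set.mem_Ioo]; omega)).1] at h1

end AutomatonCode

/-! ### The cut and paste lemma -/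

theorem mainTheorem8 :
    ∃ N N' : AutomatonCode → ℕ, Computable N ∧ Computable N' ∧
      ∀ L : Set MonoFIM, IsRationalSubset L →
        (∃ c : AutomatonCode, c.subset = L) ∧
        ∀ c : AutomatonCode, c.subset = L →
          1 ≤ N c ∧ N c ≤ N' c ∧
          ∀ (i : Fin 3) (u : MonoFIM), u ∈ MonoFIM.G (N' c) i →
            (u ∈ L ↔ MonoFIM.xi (N c) i u ∈ L) := by
  refine ⟨AutomatonCode.period, AutomatonCode.threshold,
    AutomatonCode.primrec_period.to_comp, AutomatonCode.primrec_threshold.to_comp,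
    fun L hL => ⟨hL.exists_code, ?_⟩⟩
  rintro c rfl
  have ht : c.threshold = c.period + (c.passageBound + 1) := rfl
  refine ⟨Nat.factorial_pos _, by omega, fun i u hu => ?_⟩
  have hl : MonoFIM.lam u ≤ 0 := (MonoFIM.munnTree u).left_le_zero
  have hr : MonoFIM.proj u ≤ MonoFIM.rho u := (MonoFIM.munnTree u).pt_le_right
  rw [c.mem_subset_iff, c.mem_subset_iff]
  match i, hu with
  | 0, hu =>
    -- the segment `[uλ, 0]` is shortened, its right end being kept
    obtain ⟨hu1, hu2⟩ := hu
    obtain ⟨e1, e2, e3⟩ := MonoFIM.xi_zero_spec (n := c.period) (u := u) ⟨hu1, by omega⟩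
    rw [e1, e2, e3]
    convert c.spanningWalk_iff_stretch (l := MonoFIM.lam u) (p := MonoFIM.proj u)
      (r := MonoFIM.rho u) (a := MonoFIM.lam u) (b := 0) (a' := MonoFIM.lam u + c.period) (b' := 0)
      (by omega) (by omega) le_rfl (by omega) (by simp) (by simp only [Set.mem_Ioo]; omega)
      (by simp only [NFA.stretch]; split_ifs <;> omega) using 2 <;>
      simp only [NFA.stretch] <;> split_ifs <;> omega
  | 1, hu =>
    -- the segment `[0, uπ]` is shortened, its left end being kept
    replace hu : (c.threshold : ℤ) ≤ MonoFIM.proj u := hu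
    obtain ⟨e1, e2, e3⟩ := MonoFIM.xi_one_spec (n := c.period) (u := u)
      (show (c.period : ℤ) ≤ MonoFIM.proj u by omega)
    rw [e1, e2, e3]
    convert c.spanningWalk_iff_stretch (l := MonoFIM.lam u) (p := MonoFIM.proj u)
      (r := MonoFIM.rho u) (a := 0) (b := MonoFIM.proj u) (a' := 0)
      (b' := MonoFIM.proj u - c.period)
      (by omega) (by omega) hl hr (by simp) (by simp)
      (by simp [NFA.stretch]) using 2 <;>
      simp only [NFA.stretch] <;> split_ifs <;> omega
  | 2, hu =>
    -- the segment `[uπ, uρ]` is shortened, its left end being kept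
    obtain ⟨hu1, hu2⟩ := hu
    obtain ⟨e1, e2, e3⟩ := MonoFIM.xi_two_spec (n := c.period) (u := u) ⟨hu1, by omega⟩
    rw [e1, e2, e3]
    convert c.spanningWalk_iff_stretch (l := MonoFIM.lam u) (p := MonoFIM.proj u)
      (r := MonoFIM.rho u) (a := MonoFIM.proj u) (b := MonoFIM.rho u) (a' := MonoFIM.proj u)
      (b' := MonoFIM.rho u - c.period)
      (by omega) (by omega) (by omega) le_rfl (by simp only [Set.mem_Ioo]; omega) (by simp)
      (by simp [NFA.stretch, hu1]) using 2 <;>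
      simp only [NFA.stretch] <;> split_ifs <;> omega
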